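/- Let $k,m\ge 2$ be integers and let $r\in(\mathbb Z/\mathrm{lcm}(k,m)\mathbb Z)^*$ be a unit. Write $[x,u]=xux^{-1}u^{-1}$ and write $\sim$ for conjugacy in a group. For integers $k,l,m\ge 2$ and $s\in(\mathbb Z/\mathrm{lcm}(k,l,m)\mathbb Z)^*$, a group $G$ is called $(k,l,m,s)$-quasi-Burnside if for all $x,y,z\in G$ with $xy=z$ and $x^k=y^l=z^m=1$ there exist $x',y',z'\in G$ with $x'y'=z'$, $x'\sim x^s$, $y'\sim y^s$ and $z'\sim z^s$. For $s\in(\mathbb Z/\mathrm{lcm}(k,m)\mathbb Z)^*$, a group $G$ is called $(k,m,s)$-quasi-Honda if for all $x,u,z\in G$ with $[x,u]=z$ and $x^k=z^m=1$ there exists $w\in G$ with $[x^s,w]\sim z^s$. (Here $x^s$ means $x^j$ for any integer $j$ representing $s$; under the stated conditions this does not depend on $j$.) If $\gcd(k,m)\le 2$, let $r^*$ be the unique element of $(\mathbb Z/\mathrm{lcm}(k,m)\mathbb Z)^*$ with $r^*\equiv r\pmod k$ and $r^*\equiv -r\pmod m$. Then the following are equivalent. 1. Every group is $(k,m,r)$-quasi-Honda.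 2. Every group is $(k,k,m,r)$-quasi-Burnside, or both $\gcd(k,m)\le 2$ and every group is $(k,k,m,r^*)$-quasi-Burnside. 3. We have $\frac2k+\frac1m\ge 1$, or $r\in\{\pm1\}$, or both $\gcd(k,m)\le 2$ and $r^*\in\{\pm1\}$. -/

import Mathlib

universe u

/-- The power `x ^ r` of a group element by a residue class `r` modulo `n`, computed with an integer
representative of `r`. It is used only for `x` with `x ^ n = 1`, where it does not depend on the
representative (`resPow_eq`). -/
def resPow {G : Type*} [Group G] {n : ℕ} (x : G) (r : (ZMod n)ˣ) : G :=
  x ^ ((r : ZMod n).cast : ℤ)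

theorem resPow_eq {G : Type*} [Group G] {n : ℕ} (x : G) (hx : x ^ n = 1) (r : (ZMod n)ˣ) (j : ℤ)
    (hj : (j : ZMod n) = (r : ZMod n)) : resPow x r = x ^ j := by
  have h : ((((r : ZMod n).cast : ℤ)) : ZMod n) = (j : ZMod n) := by
    rw [ZMod.intCast_zmod_cast, hj]
  have h2 : (n : ℤ) ∣ j - ((r : ZMod n).cast : ℤ) :=
    (ZMod.intCast_eq_intCast_iff_dvd_sub _ _ n).1 h
  obtain ⟨t, ht⟩ := h2
  have hj2 : j = ((r : ZMod n).cast : ℤ) + n * t := by linarith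
  rw [hj2, zpow_add, zpow_mul, zpow_natCast, hx, one_zpow, mul_one]
  rfl

/-- `G` is `(k, l, m, r)`-quasi-Burnside, where `r` is a unit modulo `lcm(k, l, m)`. -/
def IsQuasiBurnside (k l m : ℕ) (r : (ZMod (Nat.lcm (Nat.lcm k l) m))ˣ)
    (G : Type*) [Group G] : Prop :=
  ∀ x y z : G, x * y = z → x ^ k = 1 → y ^ l = 1 → z ^ m = 1 →
    ∃ x' y' z' : G, x' * y' = z' ∧
      IsConj x' (resPow x r) ∧ IsConj y' (resPow y r) ∧ IsConj z' (resPow z r)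

/-- `G` is `(k, m, r)`-quasi-Honda, where `r` is a unit modulo `lcm(k, m)`.
The commutator convention is `[x, u] = x * u * x⁻¹ * u⁻¹`. -/
def IsQuasiHonda (k m : ℕ) (r : (ZMod (Nat.lcm k m))ˣ) (G : Type*) [Group G] : Prop :=
  ∀ x u z : G, x * u * x⁻¹ * u⁻¹ = z → x ^ k = 1 → z ^ m = 1 →
    ∃ w : G, IsConj (resPow x r * w * (resPow x r)⁻¹ * w⁻¹) (resPow z r)

theorem lcm_self_lcm_dvd (k m : ℕ) : Nat.lcm (Nat.lcm k k) m ∣ Nat.lcm k m := by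
  rw [Nat.lcm_self]

/-- A unit modulo `lcm(k, m)`, regarded as a unit modulo `lcm(k, k, m)`, which is the same number. -/
def toLcmSelf (k m : ℕ) (r : (ZMod (Nat.lcm k m))ˣ) : (ZMod (Nat.lcm (Nat.lcm k k) m))ˣ :=
  ZMod.unitsMap (lcm_self_lcm_dvd k m) r

/-- `s ≡ r (mod k)` and `s ≡ -r (mod m)`. -/
def IsStar (k m : ℕ) (r s : (ZMod (Nat.lcm k m))ˣ) : Prop :=
  ZMod.unitsMap (Nat.dvd_lcm_left k m) s = ZMod.unitsMap (Nat.dvd_lcm_left k m) r ∧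
  ZMod.unitsMap (Nat.dvd_lcm_right k m) s = -ZMod.unitsMap (Nat.dvd_lcm_right k m) r

theorem existsUnique_isStar (k m : ℕ) (h : Nat.gcd k m ∣ 2) (r : (ZMod (Nat.lcm k m))ˣ) :
    ∃! s, IsStar k m r s := by
  have hk := Nat.dvd_lcm_left k m
  have hm := Nat.dvd_lcm_right k m
  obtain ⟨j, hj⟩ := ZMod.intCast_surjective (r : ZMod (Nat.lcm k m))
  have hjc : IsCoprime ((Nat.lcm k m : ℕ) : ℤ) j := by
    rw [← ZMod.coe_int_isUnit_iff_isCoprime, hj]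
    exact r.isUnit
  have hjk : IsCoprime (k : ℤ) j := hjc.of_isCoprime_of_dvd_left (by exact_mod_cast hk)
  have hjm : IsCoprime (m : ℤ) j := hjc.of_isCoprime_of_dvd_left (by exact_mod_cast hm)
  obtain ⟨c, hc⟩ := h
  have hb := Nat.gcd_eq_gcd_ab k m
  set p := Nat.gcdA k m
  set q := Nat.gcdB k m
  have h2 : (2 : ℤ) = (k * p + m * q) * c := by
    rw [← hb]
    exact_mod_cast hc
  set e : ℤ := j + k * (-(p * c * j)) with he
  have he2 : e = -j + m * (q * c * j) := by
    rw [he]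
    linear_combination (-j) * h2.symm
  have hek : IsCoprime (k : ℤ) e := by
    rw [he]
    exact (IsCoprime.add_mul_left_right_iff).2 hjk
  have hem : IsCoprime (m : ℤ) e := by
    rw [he2]
    exact (IsCoprime.add_mul_left_right_iff).2 hjm.neg_right
  have hel : IsCoprime ((Nat.lcm k m : ℕ) : ℤ) e :=
    (hek.mul_left hem).of_isCoprime_of_dvd_left (by exact_mod_cast Nat.lcm_dvd_mul k m)
  have heu : IsUnit (e : ZMod (Nat.lcm k m)) := (ZMod.coe_int_isUnit_iff_isCoprime _ _).2 hel
  refine ⟨heu.unit, ⟨?_, ?_⟩, ?_⟩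
  · apply Units.ext
    rw [ZMod.unitsMap_val, ZMod.unitsMap_val, IsUnit.unit_spec, ← hj, ZMod.cast_intCast hk,
      ZMod.cast_intCast hk, he]
    simp
  · apply Units.ext
    rw [Units.val_neg, ZMod.unitsMap_val, ZMod.unitsMap_val, IsUnit.unit_spec, ← hj,
      ZMod.cast_intCast hm, ZMod.cast_intCast hm, he2]
    simp
  · rintro s ⟨hs1, hs2⟩
    obtain ⟨i, hi⟩ := ZMod.intCast_surjective (s : ZMod (Nat.lcm k m))
    apply Units.ext
    have h1 := congrArg Units.val hs1
    have h3 := congrArg Units.val hs2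
    rw [ZMod.unitsMap_val, ZMod.unitsMap_val, ← hi, ← hj, ZMod.cast_intCast hk,
      ZMod.cast_intCast hk, ZMod.intCast_eq_intCast_iff_dvd_sub] at h1
    rw [Units.val_neg, ZMod.unitsMap_val, ZMod.unitsMap_val, ← hi, ← hj, ZMod.cast_intCast hm,
      ZMod.cast_intCast hm, ← Int.cast_neg, ZMod.intCast_eq_intCast_iff_dvd_sub] at h3
    rw [IsUnit.unit_spec, ← hi, ZMod.intCast_eq_intCast_iff_dvd_sub]
    change ((Int.lcm (k : ℤ) (m : ℤ) : ℕ) : ℤ) ∣ e - i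
    apply Int.coe_lcm_dvd
    · have : e - i = (j - i) + k * (-(p * c * j)) := by rw [he]; ring
      rw [this]
      exact dvd_add h1 (dvd_mul_right _ _)
    · have : e - i = (-j - i) + m * (q * c * j) := by rw [he2]; ring
      rw [this]
      exact dvd_add h3 (dvd_mul_right _ _)

theorem gcd_dvd_two (k m : ℕ) (hk : 2 ≤ k) (hg : Nat.gcd k m ≤ 2) : Nat.gcd k m ∣ 2 := by
  have h0 : 0 < Nat.gcd k m := Nat.gcd_pos_of_pos_left m (by omega)
  interval_cases Nat.gcd k m <;> decide

/-- The unique unit `r*` modulo `lcm(k, m)` with `r* ≡ r (mod k)` and `r* ≡ -r (mod m)`. -/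
noncomputable def starUnit (k m : ℕ) (hk : 2 ≤ k) (hg : Nat.gcd k m ≤ 2)
    (r : (ZMod (Nat.lcm k m))ˣ) : (ZMod (Nat.lcm k m))ˣ :=
  (existsUnique_isStar k m (gcd_dvd_two k m hk hg) r).choose

theorem starUnit_spec (k m : ℕ) (hk : 2 ≤ k) (hg : Nat.gcd k m ≤ 2) (r : (ZMod (Nat.lcm k m))ˣ) :
    IsStar k m r (starUnit k m hk hg r) :=
  (existsUnique_isStar k m (gcd_dvd_two k m hk hg) r).choose_spec.1

/-! Since $[x,u]=x\cdot ux^{-1}u^{-1}$, quasi-Burnside for $(k,k,m)$ applied to this product gives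
quasi-Honda. Passing from $r$ to $r^*$ changes only $z^r$ into $z^{-r}$, which is harmless because
the inverse of a commutator $[a,w]$ is conjugate to $[a,w^{-1}]$. Quasi-Burnside itself is
elementary in the listed cases: $\pm1$ is formal, $k=2$ is a dihedral computation, and the other
non-hyperbolic pairs $(k,m)$ have no units but $\pm1$.

The hard direction is from quasi-Honda to arithmetic when $2/k+1/m<1$. Let $X^k=Y^k=(XY)^m=1$ in a
group $P$. In the wreath product of $P$ by $\mathbb Z$, the delta function with value $XY$ is a
commutator of a step function and the shift. Quasi-Honda there makes $(XY)^j$ conjugate to a product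
of $X^j$ or $Y^{-j}$ with a conjugate of $X^{-j}$ or $Y^j$ (`exists_isConj_of_isQuasiHonda_wreath`).
A direct power of $P$ makes the choice uniform in $X,Y$ (`uniform_isConj_of_isQuasiHonda`).

Take $P=PSL(2,\mathbb R)$. Using $X$ twice or $Y$ twice would give a commutator with an elliptic
element, whose trace is at least $2$ in absolute value; this is impossible for suitable $X,Y$.
Otherwise the triple with angles $\pi a/k,\pi b/k,\pi c/m$ is carried to one with angles multiplied
by $j,j,\pm j$ modulo $\pi$. Elliptic triples exist for angle sum at most $\pi$ and do not exist for
sums strictly between $\pi$ and $2\pi$, so these multiplications satisfy `PreservesAngleSums`. A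
pigeonhole argument then forces the multipliers to be both $1$ or both $-1$
(`PreservesAngleSums.eq_one_or_neg_one`). -/

/-! ### Arithmetic of angle sums -/

/-- Multiplication by `(u, v)` on triples `(a, b, c)` keeps `a/k + b/k + c/m` out of `(1, 2)`. -/
def PreservesAngleSums (k m : ℕ) (ρ σ : ℤ) : Prop :=
  ∀ a b c : ℤ, 0 < a → 0 < b → 0 < c → a * m + b * m + c * k ≤ k * m →
    (ρ * a % k) * m + (ρ * b % k) * m + (σ * c % m) * k ≤ k * m ∨
      2 * (k * m) ≤ (ρ * a % k) * m + (ρ * b % k) * m + (σ * c % m) * k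

theorem mul_emod_pos {n : ℕ} {ρ a : ℤ} (hρ : IsCoprime (n : ℤ) ρ) (ha : 0 < a) (han : a < n) :
    0 < ρ * a % n := by
  have h0 : 0 ≤ ρ * a % n := Int.emod_nonneg _ (by omega)
  refine lt_of_le_of_ne h0 fun h => ?_
  have h1 : (n : ℤ) ∣ a := hρ.dvd_of_dvd_mul_left (Int.dvd_of_emod_eq_zero h.symm)
  exact absurd (Int.le_of_dvd ha h1) (by omega)

theorem neg_mul_emod {n : ℕ} {ρ a : ℤ} (hρ : IsCoprime (n : ℤ) ρ) (ha : 0 < a) (han : a < n) :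
    -ρ * a % n = n - ρ * a % n := by
  have h1 := mul_emod_pos hρ ha han
  have h2 : ρ * a % n < n := Int.emod_lt_of_pos _ (by omega)
  have h3 : -ρ * a = (n - ρ * a % n) + n * (-(ρ * a / n) - 1) := by
    have := Int.emod_add_mul_ediv (ρ * a) n
    linear_combination this
  rw [h3, Int.add_mul_emod_self_left, Int.emod_eq_of_lt (by omega) (by omega)]

theorem PreservesAngleSums.bounds {k m : ℕ} {a b c : ℤ} (hk : 0 < k) (hm : 0 < m) (ha : 0 < a)
    (hb : 0 < b) (hc : 0 < c) (h : a * m + b * m + c * k ≤ k * m) :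
    a < k ∧ b < k ∧ c < m := by
  have hk' : (0 : ℤ) < k := by exact_mod_cast hk
  have hm' : (0 : ℤ) < m := by exact_mod_cast hm
  have h1 := mul_pos ha hm'
  have h2 := mul_pos hb hm'
  have h3 := mul_pos hc hk'
  refine ⟨?_, ?_, ?_⟩
  · exact lt_of_mul_lt_mul_right (a := (m : ℤ)) (by linarith) hm'.le
  · exact lt_of_mul_lt_mul_right (a := (m : ℤ)) (by linarith) hm'.le
  · exact lt_of_mul_lt_mul_right (a := (k : ℤ)) (by linarith) hk'.le

/-- Each residue is replaced by its complement, so a weighted sum $S$ becomes $3km-S$ and the two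
alternatives are exchanged. -/
theorem PreservesAngleSums.neg {k m : ℕ} {ρ σ : ℤ} (hk : 0 < k) (hm : 0 < m)
    (hρ : IsCoprime (k : ℤ) ρ) (hσ : IsCoprime (m : ℤ) σ) (h : PreservesAngleSums k m ρ σ) :
    PreservesAngleSums k m (-ρ) (-σ) := by
  intro a b c ha hb hc habc
  obtain ⟨h1, h2, h3⟩ := PreservesAngleSums.bounds hk hm ha hb hc habc
  rw [neg_mul_emod hρ ha h1, neg_mul_emod hρ hb h2, neg_mul_emod hσ hc h3]
  rcases h a b c ha hb hc habc with h | h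
  · right; linarith
  · left; linarith

/-- The first component: `1, …, n` are mapped injectively into an interval that is too short unless
`ρ ≡ 1`. -/
theorem PreservesAngleSums.left_eq_one {k m : ℕ} {ρ σ : ℤ} (hk : 2 ≤ k) (hm : 2 ≤ m)
    (hkm : 2 * (m : ℤ) + k < k * m)
    (hρ : IsCoprime (k : ℤ) ρ) (hσ : IsCoprime (m : ℤ) σ) (h : PreservesAngleSums k m ρ σ)
    (h0 : (ρ % k) * m + (ρ % k) * m + (σ % m) * k ≤ k * m) : ρ % k = 1 := by
  have hk' : (0 : ℤ) < k := by omega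
  have hm' : (0 : ℤ) < m := by omega
  have hu : 0 < ρ % k := by simpa using mul_emod_pos hρ one_pos (by omega : (1 : ℤ) < k)
  have hv : 0 < σ % m := by simpa using mul_emod_pos hσ one_pos (by omega : (1 : ℤ) < m)
  set u := ρ % k with hudef
  set v := σ % m with hvdef
  by_contra hne
  have hu2 : 2 ≤ u := by omega
  -- The largest $a$ for which the triple $(a,1,1)$ is admissible. Its image has second entry
  -- $u\ge2$, which costs one unit and pushes $\rho a \bmod k$ below $n$.
  set n : ℤ := (k * m - m - k) / m with hn
  have hn1 : n * m ≤ k * m - m - k := Int.ediv_mul_le _ hm'.ne'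
  have hn2 : k * m - m - k < (n + 1) * m := Int.lt_ediv_add_one_mul_self _ hm'
  have hn0 : 1 ≤ n := by
    rw [hn, Int.le_ediv_iff_mul_le hm']; linarith
  have hnk : n < k := by
    refine lt_of_mul_lt_mul_right (a := (m : ℤ)) ?_ hm'.le
    linarith
  have hmaps : ∀ a ∈ Finset.Icc 1 n, ρ * a % k ∈ Finset.Icc 1 (n - 1) := by
    intro a ha
    rw [Finset.mem_Icc] at ha ⊢
    have hpos := mul_emod_pos hρ (by omega : 0 < a) (by omega : a < k)
    have hlt : ρ * a % k < k := Int.emod_lt_of_pos _ hk'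
    refine ⟨by omega, ?_⟩
    have ham : a * m ≤ n * m := mul_le_mul_of_nonneg_right ha.2 hm'.le
    have := h a 1 1 (by omega) one_pos one_pos (by linarith)
    rw [mul_one, mul_one, ← hudef, ← hvdef] at this
    have hum : 2 * (m : ℤ) ≤ u * m := mul_le_mul_of_nonneg_right hu2 hm'.le
    have hvk : 1 * (k : ℤ) ≤ v * k := mul_le_mul_of_nonneg_right hv hk'.le
    have h5 : (ρ * a % k) * m ≤ k * m := mul_le_mul_of_nonneg_right hlt.le hm'.le
    rcases this with h4 | h4
    · have : ρ * a % k < n := by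
        refine lt_of_mul_lt_mul_right (a := (m : ℤ)) ?_ hm'.le
        linarith
      omega
    · have : (0 : ℤ) < u * m := by positivity
      linarith
  have hinj : Set.InjOn (fun a : ℤ => ρ * a % k) (Finset.Icc 1 n : Finset ℤ) := by
    intro a ha b hb hab
    rw [Finset.coe_Icc, Set.mem_Icc] at ha hb
    have h1 : (k : ℤ) ∣ ρ * b - ρ * a := Int.ModEq.dvd hab
    rw [← mul_sub] at h1
    have h2 := hρ.dvd_of_dvd_mul_left h1
    have := Int.eq_zero_of_abs_lt_dvd h2 (by rw [abs_lt]; omega)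
    omega
  have := Finset.card_le_card_of_injOn _ hmaps hinj
  rw [Int.card_Icc, Int.card_Icc] at this
  omega

/-- The second component, once the first one is `1`: an initial interval of length less than `m / 2`
is mapped into itself. -/
theorem PreservesAngleSums.right_eq_one {k m : ℕ} {ρ σ : ℤ} (hk : 3 ≤ k) (hm : 2 ≤ m)
    (hσ : IsCoprime (m : ℤ) σ) (h : PreservesAngleSums k m ρ σ) (hρ1 : ρ % k = 1) :
    σ % m = 1 := by
  have hk' : (0 : ℤ) < k := by omega
  have hm' : (0 : ℤ) < m := by omega
  have hv : 0 < σ % m := by simpa using mul_emod_pos hσ one_pos (by omega : (1 : ℤ) < m)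
  have hvm : σ % m < m := Int.emod_lt_of_pos _ hm'
  set v := σ % m with hvdef
  rcases hm.eq_or_lt with hm2 | hm3
  · subst hm2; push_cast at hvm; omega
  have hρa : ∀ a : ℤ, 0 < a → a < k → ρ * a % k = a := by
    intro a h1 h2
    rw [Int.mul_emod, hρ1, one_mul, Int.emod_emod_of_dvd _ dvd_rfl, Int.emod_eq_of_lt h1.le h2]
  -- The triple $(1,k-t-1,c)$ is admissible exactly when $ck\le tm$, and its first two entries are
  -- fixed. The upper alternative would need a residue of at least $m$.
  have key : ∀ t c : ℤ, 0 < t → t ≤ k - 2 → 0 < c → c * k ≤ t * m → (v * c % m) * k ≤ t * m := by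
    intro t c ht htk hc hct
    have := h 1 (k - t - 1) c one_pos (by omega) hc (by linarith)
    rw [hρa 1 one_pos (by omega), hρa _ (by omega) (by omega)] at this
    rw [hvdef, ((Int.mod_modEq σ m).mul_right c : σ % m * c % m = σ * c % m)]
    have hlt : σ * c % m < m := Int.emod_lt_of_pos _ hm'
    have h5 : (σ * c % m) * k < m * k := mul_lt_mul_of_pos_right hlt hk'
    rcases this with h4 | h4
    · linarith
    · exfalso
      have : 0 < t * m := by positivity
      linarith
  by_contra hne
  rcases lt_or_ge m k with hmk | hmk
  -- $t=\lceil k/m\rceil$: the least $t$ that admits $c=1$. Then $tm<2k$ leaves no room for $v\ge2$.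
  · set t : ℤ := (k + m - 1) / m with ht
    have h1 : t * m ≤ k + m - 1 := Int.ediv_mul_le _ hm'.ne'
    have h2 : k + m - 1 < (t + 1) * m := Int.lt_ediv_add_one_mul_self _ hm'
    have h3 : 0 < t := by
      by_contra hh
      have : (t + 1) * m ≤ 1 * m := mul_le_mul_of_nonneg_right (by omega) hm'.le
      omega
    have h4 : t ≤ k - 2 := by
      have : t * 3 ≤ t * m := mul_le_mul_of_nonneg_left (by omega) h3.le
      nlinarith
    have := key t 1 h3 h4 one_pos (by linarith)
    rw [mul_one, Int.emod_eq_of_lt hv.le hvm] at this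
    have : 2 * (k : ℤ) ≤ v * k := mul_le_mul_of_nonneg_right (by omega) hk'.le
    omega
  · set N : ℤ := m / k with hN
    have h1 : N * k ≤ m := Int.ediv_mul_le _ hk'.ne'
    have h2 : (m : ℤ) < (N + 1) * k := Int.lt_ediv_add_one_mul_self _ hk'
    have key' : ∀ c : ℤ, 0 < c → c ≤ N → v * c % m ≤ N := by
      intro c hc hcN
      have : c * k ≤ N * k := mul_le_mul_of_nonneg_right hcN hk'.le
      have h3 := key 1 c one_pos (by omega) hc (by linarith)
      have : v * c % m < N + 1 := lt_of_mul_lt_mul_right (a := (k : ℤ)) (by linarith) hk'.le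
      omega
    have hN1 : 1 ≤ N := by
      by_contra hh
      have : (N + 1) * k ≤ 1 * k := mul_le_mul_of_nonneg_right (by omega) hk'.le
      omega
    have hN3 : N * 3 ≤ m := (mul_le_mul_of_nonneg_left (by omega) (by omega)).trans h1
    have hvN := key' 1 one_pos hN1
    rw [mul_one, Int.emod_eq_of_lt hv.le hvm] at hvN
    -- The first multiple $vc$ of $v$ beyond $N$. It is at most $N+v\le 2N<m$, so it is not reduced
    -- modulo $m$ and leaves the interval.
    set c : ℤ := N / v + 1 with hc
    have h3 : N / v * v ≤ N := Int.ediv_mul_le _ hv.ne'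
    have h4 : N < (N / v + 1) * v := Int.lt_ediv_add_one_mul_self _ hv
    have h5 : 0 ≤ N / v := Int.ediv_nonneg (by omega) hv.le
    have h6 : N / v * 2 ≤ N / v * v := mul_le_mul_of_nonneg_left (by omega) h5
    have h7 := key' c (by omega) (by omega)
    have h8 : v * c = N / v * v + v := by rw [hc]; ring
    rw [Int.emod_eq_of_lt (by positivity) (by omega)] at h7
    linarith

/-- The image of $(1,1,1)$ decides the sign: if its sum is large, negating both multipliers makes it
small. -/
theorem PreservesAngleSums.eq_one_or_neg_one {k m : ℕ} {ρ σ : ℤ} (hk : 2 ≤ k) (hm : 2 ≤ m)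
    (hkm : 2 * (m : ℤ) + k < k * m)
    (hρ : IsCoprime (k : ℤ) ρ) (hσ : IsCoprime (m : ℤ) σ) (h : PreservesAngleSums k m ρ σ) :
    ((k : ℤ) ∣ ρ - 1 ∧ (m : ℤ) ∣ σ - 1) ∨ ((k : ℤ) ∣ ρ + 1 ∧ (m : ℤ) ∣ σ + 1) := by
  have hk3 : 3 ≤ k := by
    by_contra hh
    obtain rfl : k = 2 := by omega
    push_cast at hkm
    omega
  have main : ∀ {ρ σ : ℤ}, IsCoprime (k : ℤ) ρ → IsCoprime (m : ℤ) σ →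
      PreservesAngleSums k m ρ σ → (ρ % k) * m + (ρ % k) * m + (σ % m) * k ≤ k * m →
      (k : ℤ) ∣ ρ - 1 ∧ (m : ℤ) ∣ σ - 1 := by
    intro ρ σ hρ hσ h h0
    have h1 := h.left_eq_one hk hm hkm hρ hσ h0
    have h2 := h.right_eq_one hk3 hm hσ h1
    refine ⟨?_, ?_⟩
    · rw [← h1]; exact Int.dvd_self_sub_emod
    · rw [← h2]; exact Int.dvd_self_sub_emod
  have h1 := h 1 1 1 one_pos one_pos one_pos (by linarith)
  simp only [mul_one] at h1
  rcases h1 with h1 | h1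
  · exact Or.inl (main hρ hσ h h1)
  · right
    have e1 := neg_mul_emod hρ one_pos (by omega)
    have e2 := neg_mul_emod hσ one_pos (by omega)
    simp only [mul_one] at e1 e2
    have := main hρ.neg_right hσ.neg_right (h.neg (by omega) (by omega) hρ hσ)
      (by rw [e1, e2]; linarith)
    constructor
    · rw [← dvd_neg, neg_add']; exact this.1
    · rw [← dvd_neg, neg_add']; exact this.2

/-! ### Rotations and traces in $SL(2,\mathbb R)$ -/

section PSL2

open Real MatrixGroups

/-- The rotation matrix as an element of `SL(2, ℝ)`. -/
noncomputable def rotSL (θ : ℝ) : SL(2, ℝ) :=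
  ⟨!![cos θ, -sin θ; sin θ, cos θ], by
    rw [Matrix.det_fin_two_of]; nlinarith [sin_sq_add_cos_sq θ]⟩

theorem coe_rotSL (θ : ℝ) : (rotSL θ : Matrix (Fin 2) (Fin 2) ℝ) =
    !![cos θ, -sin θ; sin θ, cos θ] := rfl

theorem rotSL_add (a b : ℝ) : rotSL (a + b) = rotSL a * rotSL b := by
  ext i j
  fin_cases i <;> fin_cases j <;> simp [coe_rotSL, cos_add, sin_add] <;> ring

theorem rotSL_zero : rotSL 0 = 1 := by
  ext i j
  fin_cases i <;> fin_cases j <;> simp [coe_rotSL]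

theorem rotSL_add_pi (a : ℝ) : rotSL (a + π) = -rotSL a := by
  ext i j
  fin_cases i <;> fin_cases j <;> simp [coe_rotSL]

theorem SL2_det_eq (g : SL(2, ℝ)) : g.1 0 0 * g.1 1 1 - g.1 0 1 * g.1 1 0 = 1 := by
  rw [← Matrix.det_fin_two]; exact g.2

theorem trace_conj_SL2 (g M : SL(2, ℝ)) :
    (g * M * g⁻¹ : SL(2, ℝ)).1.trace = M.1.trace := by
  rw [Matrix.SpecialLinearGroup.coe_mul, Matrix.trace_mul_comm,
    ← Matrix.SpecialLinearGroup.coe_mul, inv_mul_cancel_left]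

theorem trace_rotSL (θ : ℝ) : (rotSL θ).1.trace = 2 * cos θ := by
  rw [Matrix.trace_fin_two, coe_rotSL]; simp; ring

/-- The trace of a product of two rotations about different points. -/
theorem trace_rotSL_mul_conj (A B : ℝ) (g : SL(2, ℝ)) :
    (rotSL A * (g * rotSL B * g⁻¹) : SL(2, ℝ)).1.trace = 2 * cos A * cos B -
      sin A * sin B * (g.1 0 0 ^ 2 + g.1 0 1 ^ 2 + g.1 1 0 ^ 2 + g.1 1 1 ^ 2) := by
  have := SL2_det_eq g
  rw [Matrix.trace_fin_two]
  simp [Matrix.SpecialLinearGroup.coe_mul, coe_rotSL, Matrix.SpecialLinearGroup.coe_inv,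
    Matrix.adjugate_fin_two, Matrix.mul_apply, Fin.sum_univ_two]
  linear_combination (2 * cos A * cos B) * this

theorem two_le_sum_sq_SL2 (g : SL(2, ℝ)) :
    2 ≤ g.1 0 0 ^ 2 + g.1 0 1 ^ 2 + g.1 1 0 ^ 2 + g.1 1 1 ^ 2 := by
  have := SL2_det_eq g
  nlinarith [sq_nonneg (g.1 0 0 - g.1 1 1), sq_nonneg (g.1 0 1 + g.1 1 0)]

/-- Up to a common conjugation one factor is a standard rotation. The trace formula is then extremal
when the sum of squares takes its minimum $2$, where it reads $2\cos(A+B)$. -/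
theorem trace_conj_mul_conj_le {A B : ℝ} (h : 0 ≤ sin A * sin B) {x y : SL(2, ℝ)}
    (hx : IsConj (rotSL A) x) (hy : IsConj (rotSL B) y) :
    (x * y).1.trace ≤ 2 * cos (A + B) := by
  obtain ⟨g, rfl⟩ := isConj_iff.1 hx
  obtain ⟨h', rfl⟩ := isConj_iff.1 hy
  have e : g * rotSL A * g⁻¹ * (h' * rotSL B * h'⁻¹) =
      g * (rotSL A * ((g⁻¹ * h') * rotSL B * (g⁻¹ * h')⁻¹)) * g⁻¹ := by group
  rw [e, trace_conj_SL2, trace_rotSL_mul_conj, cos_add]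
  have := mul_le_mul_of_nonneg_left (two_le_sum_sq_SL2 (g⁻¹ * h')) h
  linarith

theorem le_trace_conj_mul_conj {A B : ℝ} (h : sin A * sin B ≤ 0) {x y : SL(2, ℝ)}
    (hx : IsConj (rotSL A) x) (hy : IsConj (rotSL B) y) :
    2 * cos (A + B) ≤ (x * y).1.trace := by
  obtain ⟨g, rfl⟩ := isConj_iff.1 hx
  obtain ⟨h', rfl⟩ := isConj_iff.1 hy
  have e : g * rotSL A * g⁻¹ * (h' * rotSL B * h'⁻¹) =
      g * (rotSL A * ((g⁻¹ * h') * rotSL B * (g⁻¹ * h')⁻¹)) * g⁻¹ := by group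
  rw [e, trace_conj_SL2, trace_rotSL_mul_conj, cos_add]
  have := mul_le_mul_of_nonpos_left (two_le_sum_sq_SL2 (g⁻¹ * h')) h
  linarith

/-- An elliptic element of `SL(2, ℝ)` is conjugate to the rotation with the same trace and
orientation. -/
theorem isConj_rotSL_of_trace {D : ℝ} {M : SL(2, ℝ)} (hD : 0 < sin D)
    (ht : M.1.trace = 2 * cos D) (ho : 0 < M.1 1 0 - M.1 0 1) : IsConj (rotSL D) M := by
  have hdet := SL2_det_eq M
  rw [Matrix.trace_fin_two] at ht
  set p := M.1 0 0 with hp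
  set q := M.1 0 1 with hq
  set r := M.1 1 0 with hr
  set s := M.1 1 1 with hs
  have hsc := sin_sq_add_cos_sq D
  -- $qr=ps-1\le (p+s)^2/4-1=-\sin^2D$. The orientation hypothesis then gives $r>0$.
  have hqr : q * r < 0 := by
    have : (p + s) ^ 2 = 4 * cos D ^ 2 := by rw [ht]; ring
    nlinarith [sq_nonneg (p - s), mul_pos hD hD]
  have hr0 : 0 < r := by
    by_contra hh
    nlinarith [mul_nonneg_of_nonpos_of_nonpos (not_lt.1 hh) (by linarith : q ≤ 0)]
  have hl : 0 < sin D / r := div_pos hD hr0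
  set l := √(sin D / r) with hldef
  have hl2 : l ^ 2 = sin D / r := Real.sq_sqrt hl.le
  have hl2' : l ^ 2 * r = sin D := by rw [hl2]; field_simp
  have hl0 : l ≠ 0 := (Real.sqrt_pos.2 hl).ne'
  -- The upper triangular matrix that moves $i$ to the fixed point $(p-\cos D+i\sin D)/r$ of $M$ in
  -- the upper half plane.
  let g : SL(2, ℝ) := ⟨!![l, l * (p - cos D) / sin D; 0, l * r / sin D], by
    rw [Matrix.det_fin_two_of]; field_simp; linarith⟩
  refine isConj_iff.2 ⟨g, mul_inv_eq_of_eq_mul ?_⟩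
  have hM : M.1 = !![p, q; r, s] := Matrix.eta_fin_two M.1
  apply Subtype.ext
  rw [Matrix.SpecialLinearGroup.coe_mul, Matrix.SpecialLinearGroup.coe_mul, hM, coe_rotSL]
  have hs' : s = 2 * cos D - p := by linarith
  have hqr' : q * r = 2 * p * cos D - p ^ 2 - 1 := by rw [hs'] at hdet; linarith
  simp only [g, Matrix.mul_fin_two]
  ext i j
  fin_cases i <;> fin_cases j <;> simp <;> field_simp
  · ring
  · linear_combination -hsc - hqr'
  · rw [hs']; ring

/-- This builds a hyperbolic triangle with angles $A,B,C$. The second centre is moved along a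
geodesic by $\mathrm{diag}(l,l^{-1})$ until the product has trace $-2\cos C$; the sign is that of
`rotSL (π - C)`, which is $-$`rotSL (-C)`. -/
theorem exists_rotSL_mul_conj {A B C : ℝ} (hA : 0 < A) (hB : 0 < B) (hC : 0 < C)
    (h : A + B + C ≤ π) :
    ∃ g z : SL(2, ℝ), IsConj (rotSL (-C)) z ∧ rotSL A * (g * rotSL B * g⁻¹) = -z := by
  -- $N$ below is the sum of squares of the entries of $g$ that yields this trace. The condition
  -- $N\ge2$ is $C\le\pi-(A+B)$, and $f=l^2$ solves $f+1/f=N$.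
  have hsA : 0 < sin A := sin_pos_of_pos_of_lt_pi hA (by linarith)
  have hsB : 0 < sin B := sin_pos_of_pos_of_lt_pi hB (by linarith)
  have hsC : 0 < sin C := sin_pos_of_pos_of_lt_pi hC (by linarith)
  have hsAB : 0 < sin A * sin B := mul_pos hsA hsB
  set N := (2 * cos A * cos B + 2 * cos C) / (sin A * sin B) with hN
  have hNe : N * (sin A * sin B) = 2 * cos A * cos B + 2 * cos C := div_mul_cancel₀ _ hsAB.ne'
  have h1 : cos (π - (A + B)) ≤ cos C :=
    cos_le_cos_of_nonneg_of_le_pi hC.le (by linarith) (by linarith)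
  have h2 : cos (π - (A + C)) ≤ cos B :=
    cos_le_cos_of_nonneg_of_le_pi hB.le (by linarith) (by linarith)
  rw [cos_pi_sub, cos_add] at h1 h2
  have hN2 : 2 ≤ N := by
    rw [hN, le_div_iff₀ hsAB]; linarith
  have hdisc : 0 ≤ N ^ 2 - 4 := by nlinarith
  set f := (N + √(N ^ 2 - 4)) / 2 with hf
  have hf0 : 0 < f := by have := Real.sqrt_nonneg (N ^ 2 - 4); rw [hf]; linarith
  have hfN : f ^ 2 + 1 = N * f := by
    have := Real.sq_sqrt hdisc
    rw [hf]; linear_combination this / 4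
  set l := √f with hl
  have hl0 : 0 < l := Real.sqrt_pos.2 hf0
  have hlf : l ^ 2 = f := Real.sq_sqrt hf0.le
  let g : SL(2, ℝ) := ⟨!![l, 0; 0, l⁻¹], by
    rw [Matrix.det_fin_two_of]; field_simp; ring⟩
  have hconj : (g * rotSL B * g⁻¹ : SL(2, ℝ)).1 = !![cos B, -(sin B * f); sin B / f, cos B] := by
    rw [Matrix.SpecialLinearGroup.coe_mul, Matrix.SpecialLinearGroup.coe_mul, coe_rotSL,
      Matrix.SpecialLinearGroup.coe_inv, Matrix.adjugate_fin_two, ← hlf]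
    ext i j
    fin_cases i <;> fin_cases j <;> simp [g, Matrix.mul_apply, Fin.sum_univ_two] <;> field_simp
  have hprod : (rotSL A * (g * rotSL B * g⁻¹) : SL(2, ℝ)).1 =
      !![cos A * cos B - sin A * sin B / f, -(cos A * (sin B * f)) - sin A * cos B;
        sin A * cos B + cos A * (sin B / f), cos A * cos B - sin A * (sin B * f)] := by
    rw [Matrix.SpecialLinearGroup.coe_mul, hconj, coe_rotSL, Matrix.mul_fin_two]
    ext i j
    fin_cases i <;> fin_cases j <;> simp <;> ring
  have hfi : f + 1 / f = N := by field_simp; linarith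
  have hD : IsConj (rotSL (π - C)) (rotSL A * (g * rotSL B * g⁻¹)) := by
    apply isConj_rotSL_of_trace
    · rwa [sin_pi_sub]
    · rw [hprod, Matrix.trace_fin_two, cos_pi_sub]
      simp only [Matrix.of_apply, Matrix.cons_val', Matrix.cons_val_zero, Matrix.cons_val_one,
        Matrix.cons_val_fin_one]
      linear_combination (-(sin A * sin B)) * hfi - hNe
    · rw [hprod]
      simp only [Matrix.of_apply, Matrix.cons_val', Matrix.cons_val_zero, Matrix.cons_val_one,
        Matrix.cons_val_fin_one]
      have e : sin A * cos B + cos A * (sin B / f) - (-(cos A * (sin B * f)) - sin A * cos B) =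
          2 * (cos B + cos A * cos C) / sin A := by
        rw [eq_div_iff hsA.ne']
        linear_combination (cos A * sin A * sin B) * hfi + cos A * hNe +
          2 * cos B * sin_sq_add_cos_sq A
      rw [e]
      have : 0 < sin A * sin C := mul_pos hsA hsC
      exact div_pos (by linarith) hsA
  refine ⟨g, -(rotSL A * (g * rotSL B * g⁻¹)), ?_, (neg_neg _).symm⟩
  obtain ⟨c, hc⟩ := isConj_iff.1 hD
  refine isConj_iff.2 ⟨c, ?_⟩
  rw [← hc, show π - C = -C + π by ring, rotSL_add_pi, mul_neg, neg_mul, neg_neg]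

/-- $\cos x\ge\cos(\pi-s)$ means $x\le|\pi-s|$. If no instance gives $A+B+C\le\pi$, each angle is at
most the sum of the other two minus $\pi$. -/
theorem angle_sum_of_trace_neg {A B C : ℝ} (hA : 0 < A) (hB : 0 < B) (hC : 0 < C) (hAπ : A < π)
    (hBπ : B < π) (hCπ : C < π) (h1 : cos A ≥ -cos (B + C)) (h2 : cos B ≥ -cos (A + C))
    (h3 : cos C ≥ -cos (A + B)) : A + B + C ≤ π ∨ 2 * π ≤ A + B + C := by
  have key : ∀ {x s : ℝ}, 0 < x → x < π → 0 < s → s < 2 * π → cos x ≥ -cos s →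
      x + s ≤ π ∨ x ≤ s - π := by
    intro x s hx hxπ hs hsπ h
    by_contra! hh
    have : cos x < -cos s := by
      rw [← cos_pi_sub]
      rcases le_total s π with h' | h'
      · exact cos_lt_cos_of_nonneg_of_le_pi (by linarith) hxπ.le (by linarith)
      · rw [← cos_neg (π - s), neg_sub]
        exact cos_lt_cos_of_nonneg_of_le_pi (by linarith) hxπ.le (by linarith)
    linarith
  rcases key hA hAπ (by linarith) (by linarith) h1 with h | h
  · left; linarith
  rcases key hB hBπ (by linarith) (by linarith) h2 with h' | h'
  · left; linarith
  rcases key hC hCπ (by linarith) (by linarith) h3 with h'' | h''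
  · left; linarith
  right; linarith

theorem angle_sum_of_trace_pos {A B C : ℝ} (hA : 0 < A) (hB : 0 < B) (hC : 0 < C) (hAπ : A < π)
    (hBπ : B < π) (hCπ : C < π) (h1 : cos A ≤ cos (B + C)) (h2 : cos B ≤ cos (A + C)) :
    A + B + C ≤ π ∨ 2 * π ≤ A + B + C := by
  have key : ∀ {x s : ℝ}, 0 < x → x < π → 0 < s → s < 2 * π → cos x ≤ cos s →
      s ≤ x ∨ 2 * π - s ≤ x := by
    intro x s hx hxπ hs hsπ h
    by_contra! hh
    have : cos s < cos x := by
      rcases le_total s π with h' | h'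
      · exact cos_lt_cos_of_nonneg_of_le_pi hx.le h' hh.1
      · rw [← cos_two_pi_sub]
        exact cos_lt_cos_of_nonneg_of_le_pi hx.le (by linarith) hh.2
    linarith
  rcases key hA hAπ (by linarith) (by linarith) h1 with h | h
  · rcases key hB hBπ (by linarith) (by linarith) h2 with h' | h'
    · linarith
    · right; linarith
  · right; linarith

theorem angle_sum_of_mul_eq {A B C : ℝ} (hA : 0 < A) (hB : 0 < B) (hC : 0 < C) (hAπ : A < π)
    (hBπ : B < π) (hCπ : C < π) {x y z : SL(2, ℝ)} (hx : IsConj (rotSL A) x)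
    (hy : IsConj (rotSL B) y) (hz : IsConj (rotSL (-C)) z) (h : x * y = z ∨ x * y = -z) :
    A + B + C ≤ π ∨ 2 * π ≤ A + B + C := by
  have htr : ∀ {θ : ℝ} {w : SL(2, ℝ)}, IsConj (rotSL θ) w → w.1.trace = 2 * cos θ := by
    intro θ w hw
    obtain ⟨g, rfl⟩ := isConj_iff.1 hw
    rw [trace_conj_SL2, trace_rotSL]
  have hinv : ∀ {θ : ℝ} {w : SL(2, ℝ)}, IsConj (rotSL θ) w → IsConj (rotSL (-θ)) w⁻¹ := by
    intro θ w hw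
    obtain ⟨g, rfl⟩ := isConj_iff.1 hw
    refine isConj_iff.2 ⟨g, ?_⟩
    have : rotSL (-θ) = (rotSL θ)⁻¹ := by
      rw [eq_inv_iff_mul_eq_one, ← rotSL_add, neg_add_cancel, rotSL_zero]
    rw [this]; group
  have hneg : ∀ w : SL(2, ℝ), (-w).1.trace = -w.1.trace := by
    intro w
    rw [Matrix.SpecialLinearGroup.coe_neg, Matrix.trace_neg]
  have hsA : 0 < sin A := sin_pos_of_pos_of_lt_pi hA hAπ
  have hsB : 0 < sin B := sin_pos_of_pos_of_lt_pi hB hBπ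
  have hsC : 0 < sin C := sin_pos_of_pos_of_lt_pi hC hCπ
  -- The trace bound is applied to all three pairs: $xy$, $x^{-1}z=\pm y$ and $zy^{-1}=\pm x$.
  have t3 := trace_conj_mul_conj_le (mul_pos hsA hsB).le hx hy
  have s2 : 0 ≤ sin (-A) * sin (-C) := by
    rw [sin_neg, sin_neg, neg_mul_neg]; exact (mul_pos hsA hsC).le
  have t2 := trace_conj_mul_conj_le s2 (hinv hx) hz
  have s1 : 0 ≤ sin (-C) * sin (-B) := by
    rw [sin_neg, sin_neg, neg_mul_neg]; exact (mul_pos hsC hsB).le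
  have t1 := trace_conj_mul_conj_le s1 hz (hinv hy)
  rw [← neg_add, cos_neg] at t1 t2
  have tx := htr hx
  have ty := htr hy
  have tz := htr hz
  rw [cos_neg] at tz
  rcases h with h | h
  · rw [← h, inv_mul_cancel_left, ty] at t2
    rw [← h, mul_inv_cancel_right, tx, add_comm C] at t1
    exact angle_sum_of_trace_pos hA hB hC hAπ hBπ hCπ (by linarith) (by linarith)
  · obtain rfl : z = -(x * y) := by rw [h, neg_neg]
    rw [mul_neg, inv_mul_cancel_left, hneg, ty] at t2
    rw [neg_mul, mul_inv_cancel_right, hneg, tx, add_comm C] at t1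
    rw [hneg] at tz
    exact angle_sum_of_trace_neg hA hB hC hAπ hBπ hCπ (by linarith) (by linarith) (by linarith)

/-! ### Elliptic triples in $PSL(2,\mathbb R)$ -/

/-- The rotation by `θ` as an element of `PSL(2, ℝ)`. -/
noncomputable def rotPSL (θ : ℝ) : PSL(2, ℝ) :=
  QuotientGroup.mk (rotSL θ)

theorem PSL2_mk_eq_mk {x y : SL(2, ℝ)} :
    (QuotientGroup.mk x : PSL(2, ℝ)) = QuotientGroup.mk y ↔ x = y ∨ x = -y := by
  rw [QuotientGroup.eq, Matrix.SpecialLinearGroup.mem_center_iff]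
  constructor
  · rintro ⟨r, hr, h⟩
    rw [Fintype.card_fin, sq_eq_one_iff] at hr
    rcases hr with rfl | rfl
    · left
      have : x⁻¹ * y = 1 := Subtype.ext (by rw [← h, map_one]; rfl)
      exact inv_mul_eq_one.1 this
    · right
      have : x⁻¹ * y = -1 := Subtype.ext (by
        rw [← h, map_neg, map_one, Matrix.SpecialLinearGroup.coe_neg,
          Matrix.SpecialLinearGroup.coe_one])
      rw [inv_mul_eq_iff_eq_mul.1 this, mul_neg, mul_one, neg_neg]
  · rintro (rfl | rfl)
    · exact ⟨1, by simp, by simp⟩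
    · refine ⟨-1, by simp, ?_⟩
      have : (-y)⁻¹ * y = -1 := by rw [inv_mul_eq_iff_eq_mul, neg_mul_neg, mul_one]
      rw [this, map_neg, map_one, Matrix.SpecialLinearGroup.coe_neg,
        Matrix.SpecialLinearGroup.coe_one]

theorem rotPSL_add (a b : ℝ) : rotPSL (a + b) = rotPSL a * rotPSL b := by
  rw [rotPSL, rotSL_add]; rfl

theorem rotPSL_zero : rotPSL 0 = 1 := by
  rw [rotPSL, rotSL_zero]; rfl

theorem rotPSL_int_mul (n : ℤ) (θ : ℝ) : rotPSL (n * θ) = rotPSL θ ^ n := by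
  let f : Multiplicative ℝ →* PSL(2, ℝ) :=
    { toFun x := rotPSL x.toAdd
      map_one' := rotPSL_zero
      map_mul' x y := rotPSL_add _ _ }
  have := map_zpow f (Multiplicative.ofAdd θ) n
  rw [← ofAdd_zsmul, zsmul_eq_mul] at this
  exact this

theorem rotPSL_pi : rotPSL π = 1 := by
  rw [← rotPSL_zero]
  refine PSL2_mk_eq_mk.2 (Or.inr ?_)
  rw [← rotSL_add_pi, zero_add]

theorem rotPSL_int_mul_pi (n : ℤ) : rotPSL (n * π) = 1 := by
  rw [rotPSL_int_mul, rotPSL_pi, one_zpow]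

theorem isConj_zpow {G : Type*} [Group G] {x y : G} (h : IsConj x y) (n : ℤ) :
    IsConj (x ^ n) (y ^ n) := by
  obtain ⟨g, rfl⟩ := isConj_iff.1 h
  exact isConj_iff.2 ⟨g, conj_zpow.symm⟩

theorem eq_one_of_isConj_rotPSL {n : ℕ} {θ : ℝ} {a : ℤ} (h : n * θ = a * π)
    {x : PSL(2, ℝ)} (hx : IsConj (rotPSL θ) x) : x ^ n = 1 := by
  have := isConj_zpow hx n
  rw [← rotPSL_int_mul, Int.cast_natCast, h, rotPSL_int_mul_pi, zpow_natCast] at this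
  exact isConj_one_right.1 this

theorem exists_lift_of_isConj_rotPSL {θ : ℝ} {x : PSL(2, ℝ)} (hx : IsConj (rotPSL θ) x) :
    ∃ y : SL(2, ℝ), IsConj (rotSL θ) y ∧ QuotientGroup.mk y = x := by
  obtain ⟨g, rfl⟩ := isConj_iff.1 hx
  obtain ⟨g, rfl⟩ := QuotientGroup.mk_surjective g
  exact ⟨g * rotSL θ * g⁻¹, isConj_iff.2 ⟨g, rfl⟩, rfl⟩

/-- Existence of elliptic triples with given rotation angles. -/
theorem exists_isConj_rotPSL_mul {A B C : ℝ} (hA : 0 < A) (hB : 0 < B) (hC : 0 < C)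
    (h : A + B + C ≤ π) :
    ∃ x y : PSL(2, ℝ), IsConj (rotPSL A) x ∧ IsConj (rotPSL B) y ∧
      IsConj (rotPSL (-C)) (x * y) := by
  obtain ⟨g, z, hz, hg⟩ := exists_rotSL_mul_conj hA hB hC h
  refine ⟨rotPSL A, QuotientGroup.mk (g * rotSL B * g⁻¹), IsConj.refl _,
    isConj_iff.2 ⟨QuotientGroup.mk g, rfl⟩, ?_⟩
  have e : rotPSL A * QuotientGroup.mk (g * rotSL B * g⁻¹) = QuotientGroup.mk z :=
    PSL2_mk_eq_mk.2 (Or.inr hg)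
  rw [e]
  exact (QuotientGroup.mk' (Subgroup.center SL(2, ℝ))).map_isConj hz

/-- Nonexistence of elliptic triples with given rotation angles. -/
theorem angle_sum_of_isConj_rotPSL {A B C : ℝ} (hA : 0 < A) (hB : 0 < B) (hC : 0 < C)
    (hAπ : A < π) (hBπ : B < π) (hCπ : C < π) {x y : PSL(2, ℝ)} (hx : IsConj (rotPSL A) x)
    (hy : IsConj (rotPSL B) y) (hz : IsConj (rotPSL (-C)) (x * y)) :
    A + B + C ≤ π ∨ 2 * π ≤ A + B + C := by
  obtain ⟨x, hx', rfl⟩ := exists_lift_of_isConj_rotPSL hx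
  obtain ⟨y, hy', rfl⟩ := exists_lift_of_isConj_rotPSL hy
  obtain ⟨z, hz', hxy⟩ := exists_lift_of_isConj_rotPSL hz
  exact angle_sum_of_mul_eq hA hB hC hAπ hBπ hCπ hx' hy' hz' (PSL2_mk_eq_mk.1 hxy.symm)

/-- A commutator with an elliptic element is not elliptic. -/
theorem sin_eq_zero_of_isConj_rotPSL {θ φ : ℝ} {x y : PSL(2, ℝ)} (hx : IsConj (rotPSL θ) x)
    (hy : IsConj (rotPSL (-θ)) y) (hz : IsConj (rotPSL φ) (x * y)) : sin φ = 0 := by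
  obtain ⟨x, hx', rfl⟩ := exists_lift_of_isConj_rotPSL hx
  obtain ⟨y, hy', rfl⟩ := exists_lift_of_isConj_rotPSL hy
  obtain ⟨z, hz', hxy⟩ := exists_lift_of_isConj_rotPSL hz
  -- The two sines have opposite signs, so the lifted product has trace at least $2\cos 0=2$.
  have h1 : sin θ * sin (-θ) ≤ 0 := by rw [sin_neg]; nlinarith [sq_nonneg (sin θ)]
  have h2 := le_trace_conj_mul_conj h1 hx' hy'
  rw [add_neg_cancel, cos_zero] at h2
  obtain ⟨g, rfl⟩ := isConj_iff.1 hz'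
  have h3 := trace_conj_SL2 g (rotSL φ)
  rw [trace_rotSL] at h3
  have h4 : 1 ≤ cos φ ^ 2 := by
    have hxy' : x * y = _ ∨ x * y = _ := PSL2_mk_eq_mk.1 hxy.symm
    rcases hxy' with h | h
    · rw [h, h3] at h2; nlinarith
    · rw [h, Matrix.SpecialLinearGroup.coe_neg, Matrix.trace_neg, h3] at h2; nlinarith
  have := sin_sq_add_cos_sq φ
  exact pow_eq_zero_iff two_ne_zero |>.1 (le_antisymm (by linarith) (sq_nonneg _))

theorem rotPSL_residue {n : ℕ} (hn : 0 < n) (ρ a : ℤ) :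
    rotPSL (π * (a / n)) ^ ρ = rotPSL (π * ((ρ * a % n : ℤ) / n)) := by
  have hn' : (n : ℝ) ≠ 0 := by exact_mod_cast hn.ne'
  have e : (ρ : ℝ) * (π * (a / n)) =
      π * ((ρ * a % n : ℤ) / n) + (ρ * a / n : ℤ) * π := by
    have h : ((ρ * a % n : ℤ) : ℝ) + n * (ρ * a / n : ℤ) = ρ * a := by
      exact_mod_cast Int.emod_add_mul_ediv (ρ * a) n
    field_simp
    linear_combination -h
  rw [← rotPSL_int_mul, e, rotPSL_add, rotPSL_int_mul_pi, mul_one]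

theorem angle_sum_le_iff {k m : ℕ} (hk : 0 < k) (hm : 0 < m) (a b c : ℤ) (n : ℤ) :
    π * (a / k) + π * (b / k) + π * (c / m) ≤ n * π ↔ a * m + b * m + c * k ≤ n * (k * m) := by
  have hk' : (0 : ℝ) < k := by exact_mod_cast hk
  have hm' : (0 : ℝ) < m := by exact_mod_cast hm
  have e : π * (a / k) + π * (b / k) + π * (c / m) =
      (a * m + b * m + c * k) / (k * m) * π := by field_simp
  rw [e, mul_le_mul_iff_left₀ pi_pos, div_le_iff₀ (by positivity)]
  exact_mod_cast Iff.rfl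

theorem le_angle_sum_iff {k m : ℕ} (hk : 0 < k) (hm : 0 < m) (a b c : ℤ) (n : ℤ) :
    n * π ≤ π * (a / k) + π * (b / k) + π * (c / m) ↔ n * (k * m) ≤ a * m + b * m + c * k := by
  have hk' : (0 : ℝ) < k := by exact_mod_cast hk
  have hm' : (0 : ℝ) < m := by exact_mod_cast hm
  have e : π * (a / k) + π * (b / k) + π * (c / m) =
      (a * m + b * m + c * k) / (k * m) * π := by field_simp
  rw [e, mul_le_mul_iff_left₀ pi_pos, le_div_iff₀ (by positivity)]
  exact_mod_cast Iff.rfl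

theorem pi_mul_div_pos {n : ℕ} {a : ℤ} (ha : 0 < a) (han : a < n) : 0 < π * ((a : ℝ) / n) := by
  have h1 : (0 : ℝ) < a := by exact_mod_cast ha
  have h2 : (a : ℝ) < n := by exact_mod_cast han
  exact mul_pos pi_pos (div_pos h1 (h1.trans h2))

theorem pi_mul_div_lt {n : ℕ} {a : ℤ} (ha : 0 < a) (han : a < n) : π * ((a : ℝ) / n) < π := by
  have h1 : (0 : ℝ) < a := by exact_mod_cast ha
  have h2 : (a : ℝ) < n := by exact_mod_cast han
  exact mul_lt_of_lt_one_right pi_pos ((div_lt_one (h1.trans h2)).2 h2)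

/-- A triple of elliptic elements of `PSL(2, ℝ)` with orders dividing `k`, `k` and `m`. -/
theorem exists_elliptic_triple {k m : ℕ} (hk : 0 < k) (hm : 0 < m) {a b c : ℤ} (ha : 0 < a)
    (hb : 0 < b) (hc : 0 < c) (h : a * m + b * m + c * k ≤ k * m) :
    ∃ x y : PSL(2, ℝ), x ^ k = 1 ∧ y ^ k = 1 ∧ (x * y) ^ m = 1 ∧
      IsConj (rotPSL (π * (a / k))) x ∧ IsConj (rotPSL (π * (b / k))) y ∧
      IsConj (rotPSL (π * ((-c : ℤ) / m))) (x * y) := by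
  have hk' : (k : ℝ) ≠ 0 := by exact_mod_cast hk.ne'
  have hm' : (m : ℝ) ≠ 0 := by exact_mod_cast hm.ne'
  obtain ⟨h1, h2, h3⟩ := PreservesAngleSums.bounds hk hm ha hb hc h
  have hs := (angle_sum_le_iff hk hm a b c 1).2 (by linarith)
  rw [Int.cast_one, one_mul] at hs
  obtain ⟨x, y, hx, hy, hz⟩ := exists_isConj_rotPSL_mul (pi_mul_div_pos ha h1)
    (pi_mul_div_pos hb h2) (pi_mul_div_pos hc h3) hs
  have e : -(π * ((c : ℝ) / m)) = π * ((-c : ℤ) / m) := by push_cast; ring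
  rw [e] at hz
  exact ⟨x, y, eq_one_of_isConj_rotPSL (by field_simp) hx,
    eq_one_of_isConj_rotPSL (by field_simp) hy,
    eq_one_of_isConj_rotPSL (by field_simp) hz, hx, hy, hz⟩

/-- A triple exists for the angles of $(a,b,c)$. Raising it to powers multiplies the angles modulo
$\pi$, and the obstruction applies to the resulting triple. -/
theorem preservesAngleSums_of_PSL2 {k m : ℕ} (hk : 0 < k) (hm : 0 < m) {ρ σ : ℤ}
    (hρ : IsCoprime (k : ℤ) ρ) (hσ : IsCoprime (m : ℤ) σ)
    (h : ∀ X Y : PSL(2, ℝ), X ^ k = 1 → Y ^ k = 1 → (X * Y) ^ m = 1 →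
      ∃ x y, IsConj (X ^ ρ) x ∧ IsConj (Y ^ ρ) y ∧ IsConj ((X * Y) ^ σ) (x * y)) :
    PreservesAngleSums k m ρ σ := by
  intro a b c ha hb hc habc
  obtain ⟨h1, h2, h3⟩ := PreservesAngleSums.bounds hk hm ha hb hc habc
  obtain ⟨X, Y, hX, hY, hXY, cX, cY, cZ⟩ := exists_elliptic_triple hk hm ha hb hc habc
  obtain ⟨x, y, hx, hy, hz⟩ := h X Y hX hY hXY
  have cx := (isConj_zpow cX ρ).trans hx
  have cy := (isConj_zpow cY ρ).trans hy
  have cz := (isConj_zpow cZ σ).trans hz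
  rw [rotPSL_residue hk] at cx cy
  -- The third angle is negative; the factor $-1$ is moved outside so that the residue of $\sigma c$
  -- appears, not that of $-\sigma c$.
  have e : (π * (((-c : ℤ) : ℝ) / m)) = ((-1 : ℤ) : ℝ) * (π * ((c : ℝ) / m)) := by push_cast; ring
  rw [e, rotPSL_int_mul, ← zpow_mul, mul_comm (-1 : ℤ) σ, zpow_mul, rotPSL_residue hm,
    ← rotPSL_int_mul, Int.cast_neg, Int.cast_one, neg_one_mul] at cz
  have pa := mul_emod_pos hρ ha h1
  have pb := mul_emod_pos hρ hb h2
  have pc := mul_emod_pos hσ hc h3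
  have la : ρ * a % k < k := Int.emod_lt_of_pos _ (by omega)
  have lb : ρ * b % k < k := Int.emod_lt_of_pos _ (by omega)
  have lc : σ * c % m < m := Int.emod_lt_of_pos _ (by omega)
  have := angle_sum_of_isConj_rotPSL (pi_mul_div_pos pa la) (pi_mul_div_pos pb lb)
    (pi_mul_div_pos pc lc) (pi_mul_div_lt pa la) (pi_mul_div_lt pb lb) (pi_mul_div_lt pc lc)
    cx cy cz
  refine this.imp (fun h => ?_) fun h => ?_
  · have := (angle_sum_le_iff hk hm _ _ _ 1).1 (by simpa using h)
    linarith
  · have := (le_angle_sum_iff hk hm _ _ _ 2).1 (by simpa using h)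
    linarith

/-- In `PSL(2, ℝ)` there are elliptic triples for which no power of `X * Y` prime to `m` is conjugate
to a commutator with a power of `X` or `Y`. -/
theorem exists_triple_not_isConj_commutator {k m : ℕ} (hk : 0 < k) (hm : 2 ≤ m)
    (hkm : 2 * (m : ℤ) + k < k * m) {j : ℤ} (hj : IsCoprime (m : ℤ) j) :
    ∃ X Y : PSL(2, ℝ), X ^ k = 1 ∧ Y ^ k = 1 ∧ (X * Y) ^ m = 1 ∧
      (∀ w, ¬ IsConj ((X * Y) ^ j) (X ^ j * (w * X ^ (-j) * w⁻¹))) ∧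
      ∀ w, ¬ IsConj ((X * Y) ^ j) (Y ^ (-j) * (w * Y ^ j * w⁻¹)) := by
  have hm' : (m : ℝ) ≠ 0 := by norm_cast; omega
  obtain ⟨X, Y, hX, hY, hXY, cX, cY, cZ⟩ := exists_elliptic_triple (a := 1) (b := 1) (c := 1) hk
    (by omega : 0 < m) one_pos one_pos one_pos (by linarith)
  have key : ∀ {θ : ℝ} {x : PSL(2, ℝ)}, IsConj (rotPSL θ) x → ∀ (n : ℤ) (w : PSL(2, ℝ)),
      ¬ IsConj ((X * Y) ^ j) (x ^ n * (w * x ^ (-n) * w⁻¹)) := by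
    intro θ x hx n w h
    have h1 := isConj_zpow hx n
    have h2 := (isConj_zpow hx (-n)).trans (isConj_iff.2 ⟨w, rfl⟩ :
      IsConj _ (w * x ^ (-n) * w⁻¹))
    rw [← rotPSL_int_mul] at h1 h2
    rw [Int.cast_neg, neg_mul] at h2
    have h3 := (isConj_zpow cZ j).trans h
    rw [← rotPSL_int_mul] at h3
    obtain ⟨i, hi⟩ := sin_eq_zero_iff.1 (sin_eq_zero_of_isConj_rotPSL h1 h2 h3)
    have h4 : (j : ℝ) = m * -i := by
      have : (i : ℝ) * π * m = -j * π := by rw [hi]; push_cast; field_simp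
      have := mul_right_cancel₀ pi_ne_zero (by linarith : (i : ℝ) * m * π = -j * π)
      linarith
    have h5 : (m : ℤ) ∣ j := ⟨-i, by exact_mod_cast h4⟩
    have := Int.isUnit_iff.1 (hj.isUnit_of_dvd' dvd_rfl h5)
    omega
  refine ⟨X, Y, hX, hY, hXY, fun w => key cX j w, fun w => ?_⟩
  have := key cY (-j) w
  rwa [neg_neg] at this

end PSL2

/-! ### Wreath products and uniform choice -/

/-- In the wreath product of `P` by `ℤ`, the delta function at `0` with value `X * Y` is the
commutator of a step function with values `Y⁻¹` and `X` and the shift. -/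
theorem exists_isConj_of_isQuasiHonda_wreath {k m : ℕ} {r : (ZMod (Nat.lcm k m))ˣ} {P : Type*}
    [Group P] (h : IsQuasiHonda k m r (P ≀ᵣ Multiplicative ℤ)) {j : ℤ}
    (hj : j = (r : ZMod (Nat.lcm k m)).cast) {X Y : P} (hX : X ^ k = 1) (hY : Y ^ k = 1)
    (hZ : (X * Y) ^ m = 1) :
    (∃ w, IsConj ((X * Y) ^ j) (X ^ j * (w * Y ^ j * w⁻¹))) ∨
    (∃ w, IsConj ((X * Y) ^ j) (Y ^ (-j) * (w * X ^ (-j) * w⁻¹))) ∨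
    (∃ w, IsConj ((X * Y) ^ j) (X ^ j * (w * X ^ (-j) * w⁻¹))) ∨
    (∃ w, IsConj ((X * Y) ^ j) (Y ^ (-j) * (w * Y ^ j * w⁻¹))) := by
  classical
  let L : (Multiplicative ℤ → P) →* P ≀ᵣ Multiplicative ℤ :=
    { toFun f := ⟨f, 1⟩
      map_one' := rfl
      map_mul' f g := by ext <;> simp }
  let f : Multiplicative ℤ → P := fun i => if 0 ≤ i.toAdd then X else Y⁻¹
  let d : Multiplicative ℤ → P := fun i => if i.toAdd = 0 then X * Y else 1
  let t : P ≀ᵣ Multiplicative ℤ := ⟨1, Multiplicative.ofAdd 1⟩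
  have hf : ∀ (i) (n : ℤ), (f ^ n) i = X ^ n ∨ (f ^ n) i = Y ^ (-n) := by
    intro i n
    simp only [Pi.pow_apply, f]
    split_ifs
    · simp
    · simp
  have hcomm : L f * t * (L f)⁻¹ * t⁻¹ = L d := by
    apply RegularWreathProduct.ext
    · funext i
      simp only [RegularWreathProduct.mul_left, RegularWreathProduct.inv_left, L, f, d, t,
        MonoidHom.coe_mk, OneHom.coe_mk, Pi.mul_apply, Pi.one_apply, Pi.inv_apply,
        RegularWreathProduct.mul_right, RegularWreathProduct.inv_right, one_mul, inv_one, mul_one,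
        toAdd_mul, toAdd_inv, toAdd_ofAdd]
      split_ifs <;> first | omega | simp
    · simp [L, t]
  have hfk : L f ^ k = 1 := by
    rw [← map_pow, ← map_one L]
    congr 1
    funext i
    simp only [Pi.pow_apply, f]
    split_ifs <;> simp [hX, hY]
  have hdm : L d ^ m = 1 := by
    rw [← map_pow, ← map_one L]
    congr 1
    funext i
    simp only [Pi.pow_apply, d]
    split_ifs <;> simp [hZ]
  obtain ⟨w, hw⟩ := h (L f) t (L d) hcomm hfk hdm
  obtain ⟨v, hv⟩ := isConj_iff.1 hw.symm
  have e1 : resPow (L f) r = L (f ^ j) := by rw [map_zpow, hj]; rfl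
  have e2 : resPow (L d) r = L (d ^ j) := by rw [map_zpow, hj]; rfl
  rw [e1, e2] at hv
  -- A conjugate of the delta function at $0$ by $v$ is supported at `v.right`, so the two sides are
  -- compared there.
  have hv' := congrFun (congrArg RegularWreathProduct.left hv) v.right
  simp only [RegularWreathProduct.mul_left, RegularWreathProduct.inv_left, L,
    MonoidHom.coe_mk, OneHom.coe_mk, Pi.mul_apply, Pi.inv_apply, inv_mul_cancel, mul_one,
    RegularWreathProduct.mul_right, RegularWreathProduct.inv_right, one_mul, inv_one,
    mul_inv_cancel_left] at hv'
  have hd : (d ^ j) 1 = (X * Y) ^ j := by simp [d]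
  rw [hd] at hv'
  have key : ∃ i i' w, IsConj ((X * Y) ^ j) ((f ^ j) i * (w * ((f ^ j) i')⁻¹ * w⁻¹)) := by
    refine ⟨v.right, w.right⁻¹ * v.right, w.left v.right, isConj_iff.2 ⟨v.left v.right, ?_⟩⟩
    rw [← mul_assoc, ← mul_assoc]
    exact hv'
  obtain ⟨i, i', w, hw⟩ := key
  rcases hf i j with h1 | h1 <;> rcases hf i' j with h2 | h2 <;> rw [h1, h2] at hw
  · exact Or.inr (Or.inr (Or.inl ⟨w, by simpa using hw⟩))
  · exact Or.inl ⟨w, by simpa using hw⟩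
  · exact Or.inr (Or.inl ⟨w, by simpa using hw⟩)
  · exact Or.inr (Or.inr (Or.inr ⟨w, by simpa using hw⟩))

theorem IsConj.down_apply {ι : Type*} {Q : Type*} [Group Q] {x y : ι → ULift.{u} Q}
    (h : IsConj x y) (i : ι) : IsConj (x i).down (y i).down :=
  ((MulEquiv.ulift (α := Q)).toMonoidHom.comp (Pi.evalMonoidHom (fun _ : ι => ULift.{u} Q) i)).map_isConj h

/-- If every group is quasi-Honda, then one of four kinds of relations holds uniformly for all
solutions of `X ^ k = Y ^ k = (X * Y) ^ m = 1` in a given group. -/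
theorem uniform_isConj_of_isQuasiHonda {k m : ℕ} {r : (ZMod (Nat.lcm k m))ˣ}
    (h : ∀ (G : Type u) [Group G], IsQuasiHonda k m r G) {j : ℤ}
    (hj : j = (r : ZMod (Nat.lcm k m)).cast) (Q : Type) [Group Q] :
    (∀ X Y : Q, X ^ k = 1 → Y ^ k = 1 → (X * Y) ^ m = 1 →
      ∃ w, IsConj ((X * Y) ^ j) (X ^ j * (w * Y ^ j * w⁻¹))) ∨
    (∀ X Y : Q, X ^ k = 1 → Y ^ k = 1 → (X * Y) ^ m = 1 →
      ∃ w, IsConj ((X * Y) ^ j) (Y ^ (-j) * (w * X ^ (-j) * w⁻¹))) ∨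
    (∀ X Y : Q, X ^ k = 1 → Y ^ k = 1 → (X * Y) ^ m = 1 →
      ∃ w, IsConj ((X * Y) ^ j) (X ^ j * (w * X ^ (-j) * w⁻¹))) ∨
    (∀ X Y : Q, X ^ k = 1 → Y ^ k = 1 → (X * Y) ^ m = 1 →
      ∃ w, IsConj ((X * Y) ^ j) (Y ^ (-j) * (w * Y ^ j * w⁻¹))) := by
  -- The index set is all solutions at once. One alternative for the tautological pair in the power
  -- of $Q$ then holds in every coordinate; `ULift` only adjusts the universe.
  let T := {p : Q × Q // p.1 ^ k = 1 ∧ p.2 ^ k = 1 ∧ (p.1 * p.2) ^ m = 1}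
  let X : T → ULift.{u} Q := fun p => ⟨p.1.1⟩
  let Y : T → ULift.{u} Q := fun p => ⟨p.1.2⟩
  have key := exists_isConj_of_isQuasiHonda_wreath (h ((T → ULift.{u} Q) ≀ᵣ Multiplicative ℤ)) hj
    (X := X) (Y := Y) (funext fun p => ULift.ext _ _ p.2.1) (funext fun p => ULift.ext _ _ p.2.2.1) (funext fun p => ULift.ext _ _ p.2.2.2)
  rcases key with ⟨w, hw⟩ | ⟨w, hw⟩ | ⟨w, hw⟩ | ⟨w, hw⟩
  · exact Or.inl fun x y hx hy hz =>
      ⟨(w ⟨(x, y), hx, hy, hz⟩).down, hw.down_apply ⟨(x, y), hx, hy, hz⟩⟩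
  · exact Or.inr <| Or.inl fun x y hx hy hz =>
      ⟨(w ⟨(x, y), hx, hy, hz⟩).down, hw.down_apply ⟨(x, y), hx, hy, hz⟩⟩
  · exact Or.inr <| Or.inr <| Or.inl fun x y hx hy hz =>
      ⟨(w ⟨(x, y), hx, hy, hz⟩).down, hw.down_apply ⟨(x, y), hx, hy, hz⟩⟩
  · exact Or.inr <| Or.inr <| Or.inr fun x y hx hy hz =>
      ⟨(w ⟨(x, y), hx, hy, hz⟩).down, hw.down_apply ⟨(x, y), hx, hy, hz⟩⟩

/-! ### Residue classes and integer exponents -/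

theorem resPow_toLcmSelf {G : Type*} [Group G] {k m : ℕ} {x : G} (r : (ZMod (Nat.lcm k m))ˣ)
    {j : ℤ} (hj : (j : ZMod (Nat.lcm k m)) = r) (hx : x ^ Nat.lcm k m = 1) :
    resPow x (toLcmSelf k m r) = x ^ j := by
  apply resPow_eq
  · rw [Nat.lcm_self, hx]
  · rw [toLcmSelf, ZMod.unitsMap_val, ← hj, ZMod.cast_intCast (lcm_self_lcm_dvd k m)]

theorem pow_lcm_left_eq_one {G : Type*} [Group G] {k m : ℕ} {x : G} (hx : x ^ k = 1) :
    x ^ Nat.lcm k m = 1 := by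
  obtain ⟨t, ht⟩ := Nat.dvd_lcm_left k m
  rw [ht, pow_mul, hx, one_pow]

theorem pow_lcm_right_eq_one {G : Type*} [Group G] {k m : ℕ} {x : G} (hx : x ^ m = 1) :
    x ^ Nat.lcm k m = 1 := by
  obtain ⟨t, ht⟩ := Nat.dvd_lcm_right k m
  rw [ht, pow_mul, hx, one_pow]

theorem isQuasiBurnside_toLcmSelf_iff {G : Type*} [Group G] {k m : ℕ} (r : (ZMod (Nat.lcm k m))ˣ)
    {j : ℤ} (hj : (j : ZMod (Nat.lcm k m)) = r) :
    IsQuasiBurnside k k m (toLcmSelf k m r) G ↔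
      ∀ x y : G, x ^ k = 1 → y ^ k = 1 → (x * y) ^ m = 1 →
        ∃ x' y' : G, IsConj x' (x ^ j) ∧ IsConj y' (y ^ j) ∧ IsConj (x' * y') ((x * y) ^ j) := by
  constructor
  · intro h x y hx hy hz
    obtain ⟨x', y', _, rfl, h1, h2, h3⟩ := h x y _ rfl hx hy hz
    rw [resPow_toLcmSelf r hj (pow_lcm_left_eq_one hx)] at h1
    rw [resPow_toLcmSelf r hj (pow_lcm_left_eq_one hy)] at h2
    rw [resPow_toLcmSelf r hj (pow_lcm_right_eq_one hz)] at h3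
    exact ⟨x', y', h1, h2, h3⟩
  · rintro h x y _ rfl hx hy hz
    obtain ⟨x', y', h1, h2, h3⟩ := h x y hx hy hz
    refine ⟨x', y', _, rfl, ?_⟩
    rw [resPow_toLcmSelf r hj (pow_lcm_left_eq_one hx),
      resPow_toLcmSelf r hj (pow_lcm_left_eq_one hy),
      resPow_toLcmSelf r hj (pow_lcm_right_eq_one hz)]
    exact ⟨h1, h2, h3⟩

theorem intCast_cast_unit {n : ℕ} (r : (ZMod n)ˣ) :
    (((r : ZMod n).cast : ℤ) : ZMod n) = r :=
  ZMod.intCast_zmod_cast _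

theorem isCoprime_cast_unit {n d : ℕ} (hd : d ∣ n) (r : (ZMod n)ˣ) :
    IsCoprime (d : ℤ) ((r : ZMod n).cast : ℤ) := by
  have : IsCoprime (n : ℤ) ((r : ZMod n).cast : ℤ) := by
    rw [← ZMod.coe_int_isUnit_iff_isCoprime, intCast_cast_unit]
    exact r.isUnit
  exact this.of_isCoprime_of_dvd_left (by exact_mod_cast hd)

theorem IsStar.dvd {k m : ℕ} {r s : (ZMod (Nat.lcm k m))ˣ} (h : IsStar k m r s) :
    (k : ℤ) ∣ ((s : ZMod (Nat.lcm k m)).cast : ℤ) - ((r : ZMod (Nat.lcm k m)).cast : ℤ) ∧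
    (m : ℤ) ∣ ((s : ZMod (Nat.lcm k m)).cast : ℤ) + ((r : ZMod (Nat.lcm k m)).cast : ℤ) := by
  obtain ⟨h1, h2⟩ := h
  have h1 := congrArg Units.val h1
  have h2 := congrArg Units.val h2
  rw [ZMod.unitsMap_val, ZMod.unitsMap_val, ← intCast_cast_unit r, ← intCast_cast_unit s,
    ZMod.cast_intCast (Nat.dvd_lcm_left k m), ZMod.cast_intCast (Nat.dvd_lcm_left k m),
    eq_comm, ZMod.intCast_eq_intCast_iff_dvd_sub] at h1
  rw [Units.val_neg, ZMod.unitsMap_val, ZMod.unitsMap_val, ← intCast_cast_unit r,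
    ← intCast_cast_unit s,
    ZMod.cast_intCast (Nat.dvd_lcm_right k m), ZMod.cast_intCast (Nat.dvd_lcm_right k m),
    eq_comm, ← Int.cast_neg, ZMod.intCast_eq_intCast_iff_dvd_sub, sub_neg_eq_add] at h2
  exact ⟨h1, h2⟩

theorem unit_eq_one_of_dvd {k m : ℕ} (r : (ZMod (Nat.lcm k m))ˣ)
    (h1 : (k : ℤ) ∣ ((r : ZMod (Nat.lcm k m)).cast : ℤ) - 1)
    (h2 : (m : ℤ) ∣ ((r : ZMod (Nat.lcm k m)).cast : ℤ) - 1) : r = 1 := by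
  apply Units.ext
  rw [← intCast_cast_unit r, Units.val_one, ← Int.cast_one, eq_comm,
    ZMod.intCast_eq_intCast_iff_dvd_sub]
  exact Int.coe_lcm_dvd h1 h2

theorem unit_eq_neg_one_of_dvd {k m : ℕ} (r : (ZMod (Nat.lcm k m))ˣ)
    (h1 : (k : ℤ) ∣ ((r : ZMod (Nat.lcm k m)).cast : ℤ) + 1)
    (h2 : (m : ℤ) ∣ ((r : ZMod (Nat.lcm k m)).cast : ℤ) + 1) : r = -1 := by
  apply Units.ext
  rw [← intCast_cast_unit r, Units.val_neg, Units.val_one, ← Int.cast_one, ← Int.cast_neg, eq_comm,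
    ZMod.intCast_eq_intCast_iff_dvd_sub, sub_neg_eq_add]
  exact Int.coe_lcm_dvd h1 h2

/-! ### Quasi-Burnside cases and passage to quasi-Honda -/

theorem isQuasiBurnside_of_eq_one_or {G : Type*} [Group G] {k m : ℕ} {r : (ZMod (Nat.lcm k m))ˣ}
    (h : r = 1 ∨ r = -1) : IsQuasiBurnside k k m (toLcmSelf k m r) G := by
  rcases h with rfl | rfl
  · rw [isQuasiBurnside_toLcmSelf_iff (j := 1) _ (by simp)]
    intro x y _ _ _
    exact ⟨x, y, by rw [zpow_one], by rw [zpow_one], by rw [zpow_one]⟩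
  · rw [isQuasiBurnside_toLcmSelf_iff (j := -1) _ (by simp)]
    intro x y _ _ _
    refine ⟨y⁻¹ * x⁻¹ * y, y⁻¹, isConj_iff.2 ⟨y, by group⟩, by rw [zpow_neg_one], ?_⟩
    rw [zpow_neg_one, mul_inv_rev, mul_inv_cancel_right]

/-- Dihedral groups: an odd power of a product of two involutions is a product of conjugates of
these involutions. -/
theorem isQuasiBurnside_two {G : Type*} [Group G] {m : ℕ} (r : (ZMod (Nat.lcm 2 m))ˣ) :
    IsQuasiBurnside 2 2 m (toLcmSelf 2 m r) G := by
  rw [isQuasiBurnside_toLcmSelf_iff r (intCast_cast_unit r)]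
  have hodd := isCoprime_cast_unit (Nat.dvd_lcm_left 2 m) r
  set j : ℤ := (r : ZMod (Nat.lcm 2 m)).cast
  obtain ⟨i, hi⟩ : Odd j := by
    rw [← Int.not_even_iff_odd, even_iff_two_dvd]
    intro h
    have := Int.isUnit_iff.1 (hodd.isUnit_of_dvd' dvd_rfl (by exact_mod_cast h))
    norm_num at this
  intro x y hx hy _
  have hpow : ∀ w : G, w ^ 2 = 1 → w ^ j = w := by
    intro w hw
    rw [hi, zpow_add, zpow_mul, zpow_one]
    have : w ^ (2 : ℤ) = 1 := by exact_mod_cast hw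
    rw [this, one_zpow, one_mul]
  rw [hpow x hx, hpow y hy]
  have hx' : x⁻¹ = x := by rw [inv_eq_iff_mul_eq_one, ← sq, hx]
  have hy' : y⁻¹ = y := by rw [inv_eq_iff_mul_eq_one, ← sq, hy]
  have hyz : ∀ n : ℤ, y * (x * y) ^ n = (x * y) ^ (-n) * y := by
    intro n
    have h1 : y * (x * y) * y⁻¹ = (x * y)⁻¹ := by
      rw [mul_inv_rev, hx', hy', mul_assoc, mul_assoc, ← sq, hy, mul_one]
    have h2 := congrArg (· ^ n) h1
    simp only [conj_zpow, inv_zpow'] at h2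
    rw [← h2, inv_mul_cancel_right]
  -- With $j=2i+1$ and $y$ inverting $xy$, one has $x(xy)^{-i}y(xy)^i=xy(xy)^{2i}$.
  refine ⟨x, (x * y) ^ (-i) * y * ((x * y) ^ (-i))⁻¹, IsConj.refl _,
    (isConj_iff.2 ⟨_, rfl⟩ : IsConj y _).symm, ?_⟩
  have e : x * ((x * y) ^ (-i) * y * ((x * y) ^ (-i))⁻¹) = (x * y) ^ j := by
    rw [← hyz, zpow_neg, inv_inv, mul_assoc, ← zpow_add, ← mul_assoc, hi, ← zpow_one_add]
    congr 1
    ring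
  rw [e]

theorem isQuasiHonda_of_isQuasiBurnside {G : Type*} [Group G] {k m : ℕ}
    {r : (ZMod (Nat.lcm k m))ˣ} (h : IsQuasiBurnside k k m (toLcmSelf k m r) G) :
    IsQuasiHonda k m r G := by
  rw [isQuasiBurnside_toLcmSelf_iff r (intCast_cast_unit r)] at h
  rintro x u _ rfl hx hz
  have e : x * u * x⁻¹ * u⁻¹ = x * (u * x⁻¹ * u⁻¹) := by group
  have hy : (u * x⁻¹ * u⁻¹) ^ k = 1 := by rw [conj_pow, inv_pow, hx]; group
  rw [e] at hz ⊢
  obtain ⟨x', y', h1, h2, h3⟩ := h x (u * x⁻¹ * u⁻¹) hx hy hz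
  obtain ⟨g, rfl⟩ := isConj_iff.1 h1.symm
  obtain ⟨v, rfl⟩ := isConj_iff.1 h2.symm
  -- Conjugating $x'y'$ by $g^{-1}$ leaves $x^r$ times the conjugate of $x^{-r}$ by $g^{-1}vu$.
  refine ⟨g⁻¹ * v * u, IsConj.trans (isConj_iff.2 ⟨g, ?_⟩) h3⟩
  rw [resPow, conj_zpow, inv_zpow]
  group

/-- Here $x^s=x^r$ and $z^s=z^{-r}$, and $[a,w]^{-1}=w[a,w^{-1}]w^{-1}$. -/
theorem isQuasiHonda_of_isQuasiBurnside_star {G : Type*} [Group G] {k m : ℕ}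
    {r s : (ZMod (Nat.lcm k m))ˣ} (hs : IsStar k m r s)
    (h : IsQuasiBurnside k k m (toLcmSelf k m s) G) : IsQuasiHonda k m r G := by
  obtain ⟨d1, d2⟩ := hs.dvd
  rintro x u z hxu hx hz
  obtain ⟨w, hw⟩ := isQuasiHonda_of_isQuasiBurnside h x u z hxu hx hz
  have e1 : resPow x s = resPow x r := by
    obtain ⟨t, ht⟩ := d1
    rw [resPow, resPow, sub_eq_iff_eq_add.1 ht, zpow_add, zpow_mul, zpow_natCast, hx, one_zpow,
      one_mul]
  have e2 : resPow z s = (resPow z r)⁻¹ := by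
    obtain ⟨t, ht⟩ := d2
    rw [resPow, resPow, eq_sub_of_add_eq ht, zpow_sub, zpow_mul, zpow_natCast, hz, one_zpow,
      one_mul]
  rw [e1, e2] at hw
  obtain ⟨c, hc⟩ := isConj_iff.1 hw
  refine ⟨w⁻¹, isConj_iff.2 ⟨c * w, ?_⟩⟩
  rw [← inv_inv (resPow z r), ← hc]
  group

/-! ### Arithmetic consequences and small exponents -/

theorem dvd_of_forall_isQuasiHonda {k m : ℕ} (hk : 2 ≤ k) (hm : 2 ≤ m)
    (hkm : 2 * (m : ℤ) + k < k * m) {r : (ZMod (Nat.lcm k m))ˣ}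
    (h : ∀ (G : Type u) [Group G], IsQuasiHonda k m r G) {j : ℤ}
    (hj : j = (r : ZMod (Nat.lcm k m)).cast) :
    (((k : ℤ) ∣ j - 1 ∧ (m : ℤ) ∣ j - 1) ∨ ((k : ℤ) ∣ j + 1 ∧ (m : ℤ) ∣ j + 1)) ∨
    (((k : ℤ) ∣ j - 1 ∧ (m : ℤ) ∣ j + 1) ∨ ((k : ℤ) ∣ j + 1 ∧ (m : ℤ) ∣ j - 1)) := by
  have hkj : IsCoprime (k : ℤ) j := hj ▸ isCoprime_cast_unit (Nat.dvd_lcm_left k m) r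
  have hmj : IsCoprime (m : ℤ) j := hj ▸ isCoprime_cast_unit (Nat.dvd_lcm_right k m) r
  obtain ⟨X, Y, hX, hY, hXY, hcX, hcY⟩ :=
    exists_triple_not_isConj_commutator (by omega : 0 < k) hm hkm hmj
  rcases uniform_isConj_of_isQuasiHonda h hj
      (Matrix.ProjectiveSpecialLinearGroup (Fin 2) ℝ) with H | H | H | H
  · left
    refine (preservesAngleSums_of_PSL2 (by omega) (by omega) hkj hmj ?_).eq_one_or_neg_one hk hm
      hkm hkj hmj
    intro X Y hX hY hXY
    obtain ⟨w, hw⟩ := H X Y hX hY hXY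
    exact ⟨_, _, IsConj.refl _, isConj_iff.2 ⟨w, rfl⟩, hw⟩
  · right
    have := (preservesAngleSums_of_PSL2 (k := k) (m := m) (ρ := j) (σ := -j) (by omega) (by omega)
      hkj hmj.neg_right ?_).eq_one_or_neg_one hk hm hkm hkj hmj.neg_right
    · rwa [← neg_add', dvd_neg, neg_add_eq_sub, dvd_sub_comm (b := 1)] at this
    intro X Y hX hY hXY
    obtain ⟨w, hw⟩ := H X Y hX hY hXY
    -- Inverting the relation turns it into one for $(XY)^{-j}$, so the multipliers are $j$ and
    -- $-j$.
    refine ⟨w * X ^ j * w⁻¹, Y ^ j, isConj_iff.2 ⟨w, rfl⟩, IsConj.refl _, ?_⟩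
    have := isConj_zpow hw (-1)
    rw [← zpow_mul, mul_neg_one] at this
    convert this using 1
    group
  · obtain ⟨w, hw⟩ := H X Y hX hY hXY
    exact absurd hw (hcX w)
  · obtain ⟨w, hw⟩ := H X Y hX hY hXY
    exact absurd hw (hcY w)

theorem gcd_le_two_of_dvd {k m : ℕ} {j : ℤ}
    (h : ((k : ℤ) ∣ j - 1 ∧ (m : ℤ) ∣ j + 1) ∨ ((k : ℤ) ∣ j + 1 ∧ (m : ℤ) ∣ j - 1)) :
    Nat.gcd k m ≤ 2 := by
  have hk : ((Nat.gcd k m : ℕ) : ℤ) ∣ k := by exact_mod_cast Nat.gcd_dvd_left k m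
  have hm : ((Nat.gcd k m : ℕ) : ℤ) ∣ m := by exact_mod_cast Nat.gcd_dvd_right k m
  have : ((Nat.gcd k m : ℕ) : ℤ) ∣ 2 := by
    rcases h with ⟨h1, h2⟩ | ⟨h1, h2⟩
    · have := dvd_sub (hm.trans h2) (hk.trans h1)
      ring_nf at this
      exact this
    · have := dvd_sub (hk.trans h1) (hm.trans h2)
      ring_nf at this
      exact this
  exact Nat.le_of_dvd two_pos (by exact_mod_cast this)

theorem ZMod.units_eq_one_or_neg_one {n : ℕ} (hn : n = 3 ∨ n = 4 ∨ n = 6) (r : (ZMod n)ˣ) :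
    r = 1 ∨ r = -1 := by
  rcases hn with rfl | rfl | rfl <;> revert r <;> decide

/-- For $k\ge3$ only $(3,2)$, $(3,3)$ and $(4,2)$ remain, with least common multiples $6$, $3$ and
$4$. -/
theorem eq_two_or_units_trivial {k m : ℕ} (hk : 2 ≤ k) (hm : 2 ≤ m)
    (h : (2 : ℚ) / k + 1 / m ≥ 1) :
    k = 2 ∨ ∀ r : (ZMod (Nat.lcm k m))ˣ, r = 1 ∨ r = -1 := by
  have hk' : (0 : ℚ) < k := by norm_cast; omega
  have hm' : (0 : ℚ) < m := by norm_cast; omega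
  rw [ge_iff_le, div_add_div _ _ hk'.ne' hm'.ne', le_div_iff₀ (by positivity)] at h
  have h' : k * m ≤ 2 * m + k := by
    have : (k * m : ℚ) ≤ 2 * m + k := by linarith
    exact_mod_cast this
  rcases hk.eq_or_lt with rfl | hk3
  · exact Or.inl rfl
  right
  have hk4 : k ≤ 4 := by nlinarith
  have hm3 : m ≤ 3 := by nlinarith
  interval_cases k <;> interval_cases m <;> first | omega | exact ZMod.units_eq_one_or_neg_one (by decide)

theorem theorem1p1 (k m : ℕ) (hk : 2 ≤ k) (hm : 2 ≤ m) (r : (ZMod (Nat.lcm k m))ˣ) :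
    List.TFAE [
      ∀ (G : Type u) [Group G], IsQuasiHonda k m r G,
      (∀ (G : Type u) [Group G], IsQuasiBurnside k k m (toLcmSelf k m r) G) ∨
        ∃ hg : Nat.gcd k m ≤ 2,
          ∀ (G : Type u) [Group G],
            IsQuasiBurnside k k m (toLcmSelf k m (starUnit k m hk hg r)) G,
      (2 : ℚ) / k + 1 / m ≥ 1 ∨ (r = 1 ∨ r = -1) ∨
        ∃ hg : Nat.gcd k m ≤ 2, starUnit k m hk hg r = 1 ∨ starUnit k m hk hg r = -1
    ] := by
  tfae_have 1 → 3 := by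
    intro h
    refine or_iff_not_imp_left.2 fun hhyp => ?_
    have hkm : 2 * (m : ℤ) + k < k * m := by
      have hk' : (0 : ℚ) < k := by norm_cast; omega
      have hm' : (0 : ℚ) < m := by norm_cast; omega
      rw [ge_iff_le, not_le, div_add_div _ _ hk'.ne' hm'.ne', div_lt_iff₀ (by positivity)] at hhyp
      have : (2 * m + k : ℚ) < k * m := by linarith
      exact_mod_cast this
    refine (dvd_of_forall_isQuasiHonda hk hm hkm h rfl).imp (fun h => ?_) fun h => ?_
    · exact h.imp (fun h => unit_eq_one_of_dvd r h.1 h.2) fun h => unit_eq_neg_one_of_dvd r h.1 h.2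
    · have hg := gcd_le_two_of_dvd h
      obtain ⟨d1, d2⟩ := (starUnit_spec k m hk hg r).dvd
      refine ⟨hg, h.imp (fun h => ?_) fun h => ?_⟩
      · apply unit_eq_one_of_dvd
        · simpa using dvd_add d1 h.1
        · simpa [← sub_sub] using dvd_sub d2 h.2
      · apply unit_eq_neg_one_of_dvd
        · simpa [← add_assoc] using dvd_add d1 h.1
        · simpa [sub_sub_eq_add_sub, add_right_comm] using dvd_sub d2 h.2
  tfae_have 3 → 2 := by
    rintro (h | h | ⟨hg, h⟩)
    · left
      intro G _
      rcases eq_two_or_units_trivial hk hm h with rfl | h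
      · exact isQuasiBurnside_two r
      · exact isQuasiBurnside_of_eq_one_or (h r)
    · exact Or.inl fun G _ => isQuasiBurnside_of_eq_one_or h
    · exact Or.inr ⟨hg, fun G _ => isQuasiBurnside_of_eq_one_or h⟩
  tfae_have 2 → 1 := by
    rintro (h | ⟨hg, h⟩) G _
    · exact isQuasiHonda_of_isQuasiBurnside (h G)
    · exact isQuasiHonda_of_isQuasiBurnside_star (starUnit_spec k m hk hg r) (h G)
  tfae_finish
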